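/- Let $d\ge 1$, and equip $\mathrm{SL}(d,\mathbb{R})$ with its usual topology and Borel $\sigma$-algebra. Let $\mathbf{K}$ be a set of Borel probability measures on $\mathrm{SL}(d,\mathbb{R})$ that is compact in the topology of weak convergence (convergence of integrals of bounded continuous functions). Let $\|A\|$ be the operator norm with respect to the Euclidean norm on $\mathbb{R}^d$, and for $A\in\mathrm{SL}(d,\mathbb{R})$ let $f_A:\mathbb{RP}^{d-1}\to\mathbb{RP}^{d-1}$, $[v]\mapsto[Av]$, be the induced projective transformation. For $\mu_1,\dots,\mu_n\in\mathbf{K}$ set $$L_n=L_n(\mu_1,\dots,\mu_n)=\mathbb{E}\,\log\|A_nA_{n-1}\cdots A_1\|,$$ where $(A_1,\dots,A_n)$ is distributed according to the product measure $\mu_1\times\dots\times\mu_n$. Assume that 1. (log-moment condition) for every $\mu\in\mathbf{K}$, $\int_{\mathrm{SL}(d,\mathbb{R})}\log\|A\|\,d\mu(A)<\infty$; 2. (measures condition) for every $\mu\in\mathbf{K}$ there are no Borel probability measures $\nu_1,\nu_2$ on $\mathbb{RP}^{d-1}$ such that $(f_A)_*\nu_1=\nu_2$ for $\mu$-almost every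 $A\in\mathrm{SL}(d,\mathbb{R})$. Then there exists $\lambda>0$ such that for every $n$ and all $\mu_1,\dots,\mu_n\in\mathbf{K}$ the expectation $L_n$ exists and is finite, and $$L_n\ge n\lambda .$$ In particular, with the same $\lambda$, for every sequence $(\mu_i)_{i\in\mathbb{N}}\in\mathbf{K}^{\mathbb{N}}$, writing $L_n=L_n(\mu_1,\dots,\mu_n)$, $$\liminf_{n\to\infty}\frac1n L_n\ge\lambda>0,$$ where the lower limit is taken in $[-\infty,+\infty]$. -/

import Mathlib

open MeasureTheory Filter Topology
open scoped LinearAlgebra.Projectivization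

namespace RandomMatrix

/-- The group `SL(d, ℝ)`, with Mathlib's topology (induced from the space of matrices). -/
abbrev SLd (d : ℕ) : Type := Matrix.SpecialLinearGroup (Fin d) ℝ

/-- The Borel σ-algebra on `SL(d, ℝ)`. -/
instance instMeasurableSpaceSLd (d : ℕ) : MeasurableSpace (SLd d) := borel _

instance instBorelSpaceSLd (d : ℕ) : BorelSpace (SLd d) := ⟨rfl⟩

/-- The real projective space `ℝP^{d-1}`, the set of lines through the origin in `ℝ^d`. -/
abbrev RPd (d : ℕ) : Type := ℙ ℝ (Fin d → ℝ)

/-- The quotient topology of `ℝ^d ∖ {0}` by the multiplicative action of `ℝ ∖ {0}`. -/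
noncomputable instance instTopologicalSpaceRPd (d : ℕ) : TopologicalSpace (RPd d) :=
  TopologicalSpace.coinduced
    (fun v : {v : Fin d → ℝ // v ≠ 0} => (Projectivization.mk ℝ v.1 v.2 : RPd d)) inferInstance

/-- The Borel σ-algebra on `ℝP^{d-1}`. -/
noncomputable instance instMeasurableSpaceRPd (d : ℕ) : MeasurableSpace (RPd d) := borel _

instance instBorelSpaceRPd (d : ℕ) : BorelSpace (RPd d) := ⟨rfl⟩

/-- The projective transformation `f_A : ℝP^{d-1} → ℝP^{d-1}`, `[v] ↦ [A v]`. -/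
noncomputable def projMap {d : ℕ} (A : SLd d) : RPd d → RPd d := fun x => A • x

theorem projMap_mk {d : ℕ} (A : SLd d) (v : Fin d → ℝ) (hv : v ≠ 0)
    (hAv : (A : Matrix (Fin d) (Fin d) ℝ).mulVec v ≠ 0) :
    projMap A (Projectivization.mk ℝ v hv) = Projectivization.mk ℝ _ hAv := rfl

/-- `f_A` is continuous, hence Borel, so that the push-forwards under `f_A` are genuine. -/
theorem continuous_projMap {d : ℕ} (A : SLd d) : Continuous (projMap A) := by
  refine continuous_coinduced_dom.2 ?_
  have hne : ∀ v : {v : Fin d → ℝ // v ≠ 0}, A • v.1 ≠ 0 :=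
    fun v => (smul_ne_zero_iff_ne A).mpr v.2
  have hc : Continuous (fun v : {v : Fin d → ℝ // v ≠ 0} =>
      (⟨A • v.1, hne v⟩ : {v : Fin d → ℝ // v ≠ 0})) :=
    Continuous.subtype_mk
      (show Continuous fun v : {v : Fin d → ℝ // v ≠ 0} =>
          (A : Matrix (Fin d) (Fin d) ℝ).mulVec v.1 from
        Continuous.matrix_mulVec continuous_const continuous_subtype_val) _
  exact (continuous_coinduced_rng (f := fun v : {v : Fin d → ℝ // v ≠ 0} =>
    (Projectivization.mk ℝ v.1 v.2 : RPd d))).comp hc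

theorem measurable_projMap {d : ℕ} (A : SLd d) : Measurable (projMap A) :=
  (continuous_projMap A).measurable

/-- The operator norm of `A` with respect to the Euclidean norm on `ℝ^d`. -/
noncomputable def opNorm {d : ℕ} (A : SLd d) : ℝ :=
  ‖Matrix.toEuclideanCLM (n := Fin d) (𝕜 := ℝ) (A : Matrix (Fin d) (Fin d) ℝ)‖

/-- The log-moment condition for one law: `∫ log ‖A‖ dμ(A)` is finite. -/
def LogMomentCondition {d : ℕ} (μ : ProbabilityMeasure (SLd d)) : Prop :=
  Integrable (fun A : SLd d => Real.log (opNorm A)) (μ : Measure (SLd d))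

/-- The measures condition for one law: there are no Borel probability measures `ν₁`, `ν₂` on
`ℝP^{d-1}` with `(f_A)_* ν₁ = ν₂` for `μ`-almost every `A`. -/
def MeasuresCondition {d : ℕ} (μ : ProbabilityMeasure (SLd d)) : Prop :=
  ¬ ∃ ν₁ ν₂ : ProbabilityMeasure (RPd d),
    ∀ᵐ A ∂(μ : Measure (SLd d)),
      Measure.map (projMap A) (ν₁ : Measure (RPd d)) = (ν₂ : Measure (RPd d))

/-- The product `T_n = A_n A_{n-1} ⋯ A_1` of a finite sequence of matrices; `A_{i+1}` is written
`A i` for `i : Fin n`. -/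
def orderedProduct {d n : ℕ} (A : Fin n → SLd d) : SLd d := (List.ofFn A).reverse.prod

/-- The product law `μ_1 × ⋯ × μ_n` of independent `A_1, …, A_n`. -/
noncomputable def productLaw {d n : ℕ} (μ : Fin n → ProbabilityMeasure (SLd d)) :
    Measure (Fin n → SLd d) :=
  Measure.pi (fun i => (μ i : Measure (SLd d)))

/-- `L_n = E log ‖T_n‖`, the expectation being over `μ_1 × ⋯ × μ_n`. -/
noncomputable def expectedLogNorm {d n : ℕ} (μ : Fin n → ProbabilityMeasure (SLd d)) : ℝ :=
  ∫ A, Real.log (opNorm (orderedProduct A)) ∂(productLaw μ)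

end RandomMatrix

/-! Matrices of determinant one preserve Lebesgue measure, so each `A` acts isometrically on
`L²(ℝ^d)` by `g ↦ g ∘ A`, and a law `μ` acts by the average `koopman μ` of these isometries. The
core is that this average has norm at most some `q < 1`, uniformly over `K`. If unit vectors `φ`,
`ψ` have averaged correlation near `1`, then `φ ∘ A` is `L²`-close to `ψ` for most `A`, hence `(φ ∘
A)²` is `L¹`-close to `ψ²`. On the projective space this says that `f_A` almost carries the law of
lines of `ψ²` to that of `φ²`. The measures condition, made quantitative by compactness of `K` and
of the space of probability measures on `ℝP^{d-1}`, forbids this (`exists_uniform_discrepancy`,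
`sq_deviation_le`, `exists_koopman_gap`).

Independence turns the operator of the product `T_n` into a composition, of norm at most `q ^ n`.
Testing it on the indicator of the unit ball, which overlaps its preimage under `A` in volume at
least `‖A‖^{-d}` times that of the ball, gives `E ‖T_n‖^{-d} ≤ q ^ n`. Jensen's inequality then
yields `L_n ≥ n (-log q) / d`. -/

namespace RandomMatrix

/-! ### Topology of the matrix group and of the projective space. -/

instance instSecondCountableTopologySLd (d : ℕ) : SecondCountableTopology (SLd d) :=
  haveI : SecondCountableTopology (Matrix (Fin d) (Fin d) ℝ) :=
    inferInstanceAs (SecondCountableTopology (Fin d → Fin d → ℝ))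
  Matrix.SpecialLinearGroup.isClosedEmbedding_val.isEmbedding.secondCountableTopology

instance instMetrizableSpaceSLd (d : ℕ) : TopologicalSpace.MetrizableSpace (SLd d) :=
  haveI : TopologicalSpace.MetrizableSpace (Matrix (Fin d) (Fin d) ℝ) :=
    inferInstanceAs (TopologicalSpace.MetrizableSpace (Fin d → Fin d → ℝ))
  Matrix.SpecialLinearGroup.isClosedEmbedding_val.isEmbedding.metrizableSpace

theorem smul_eq_mulVec {d : ℕ} (A : SLd d) (v : Fin d → ℝ) :
    A • v = (A : Matrix (Fin d) (Fin d) ℝ).mulVec v := rfl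

instance instContinuousSMulSLd (d : ℕ) : ContinuousSMul (SLd d) (Fin d → ℝ) where
  continuous_smul := by
    change Continuous fun p : SLd d × (Fin d → ℝ) =>
      (p.1 : Matrix (Fin d) (Fin d) ℝ).mulVec p.2
    exact Continuous.matrix_mulVec (continuous_subtype_val.comp continuous_fst) continuous_snd

/-- The orthogonal projection onto a line, as a matrix. -/
noncomputable def lineProj {d : ℕ} : RPd d → Matrix (Fin d) (Fin d) ℝ :=
  Projectivization.lift (fun v : {v : Fin d → ℝ // v ≠ 0} =>
      (v.1 ⬝ᵥ v.1)⁻¹ • Matrix.vecMulVec v.1 v.1) (by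
    rintro ⟨v, hv⟩ ⟨w, hw⟩ t (h : v = t • w)
    subst h
    have ht : t ≠ 0 := by rintro rfl; simp at hv
    ext i j
    simp only [Matrix.smul_apply, Matrix.vecMulVec_apply, smul_dotProduct, dotProduct_smul,
      Pi.smul_apply, smul_eq_mul]
    have : w ⬝ᵥ w ≠ 0 := by simpa using hw
    field_simp)

theorem lineProj_mk {d : ℕ} (v : Fin d → ℝ) (hv : v ≠ 0) :
    lineProj (Projectivization.mk ℝ v hv) = (v ⬝ᵥ v)⁻¹ • Matrix.vecMulVec v v := rfl

theorem continuous_mk {d : ℕ} : Continuous (fun v : {v : Fin d → ℝ // v ≠ 0} =>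
    (Projectivization.mk ℝ v.1 v.2 : RPd d)) := continuous_coinduced_rng

theorem continuous_lineProj {d : ℕ} : Continuous (lineProj (d := d)) := by
  refine continuous_coinduced_dom.2 ?_
  change Continuous fun v : {v : Fin d → ℝ // v ≠ 0} =>
      (v.1 ⬝ᵥ v.1)⁻¹ • Matrix.vecMulVec v.1 v.1
  have h1 : Continuous fun v : {v : Fin d → ℝ // v ≠ 0} => v.1 ⬝ᵥ v.1 :=
    Continuous.dotProduct continuous_subtype_val continuous_subtype_val
  have h2 : Continuous fun v : {v : Fin d → ℝ // v ≠ 0} => Matrix.vecMulVec v.1 v.1 :=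
    Continuous.matrix_vecMulVec continuous_subtype_val continuous_subtype_val
  exact (h1.inv₀ fun v => by simpa using v.2).smul h2

/-- Apply both projections to `v`: the first fixes it, the second returns a multiple of `w`. -/
theorem lineProj_injective {d : ℕ} : Function.Injective (lineProj (d := d)) := by
  intro x y h
  induction x using Projectivization.ind with | _ v hv
  induction y using Projectivization.ind with | _ w hw
  rw [lineProj_mk, lineProj_mk] at h
  have hv' : v ⬝ᵥ v ≠ 0 := by simpa using hv
  have h2 := congrArg (fun M => Matrix.mulVec M v) h
  simp only [Matrix.smul_mulVec, Matrix.vecMulVec_mulVec] at h2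
  rw [Projectivization.mk_eq_mk_iff']
  refine ⟨(w ⬝ᵥ w)⁻¹ * (w ⬝ᵥ v), ?_⟩
  ext i
  have := congrFun h2 i
  simp only [Pi.smul_apply, smul_eq_mul, MulOpposite.smul_eq_mul_unop, MulOpposite.unop_op] at this ⊢
  field_simp at this
  rw [this]
  ring

instance instCompactSpaceRPd (d : ℕ) : CompactSpace (RPd d) := by
  have hc : Continuous (fun v : Metric.sphere (0 : Fin d → ℝ) 1 =>
      (Projectivization.mk ℝ v.1 (ne_zero_of_mem_unit_sphere v) : RPd d)) :=
    continuous_mk.comp (Continuous.subtype_mk continuous_subtype_val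
      fun v => ne_zero_of_mem_unit_sphere v)
  have hs : Function.Surjective (fun v : Metric.sphere (0 : Fin d → ℝ) 1 =>
      (Projectivization.mk ℝ v.1 (ne_zero_of_mem_unit_sphere v) : RPd d)) := by
    intro x
    induction x using Projectivization.ind with | _ v hv
    have hv' : ‖v‖ ≠ 0 := norm_ne_zero_iff.2 hv
    refine ⟨⟨‖v‖⁻¹ • v, by simp [norm_smul, hv']⟩, ?_⟩
    rw [Projectivization.mk_eq_mk_iff']
    exact ⟨‖v‖⁻¹, rfl⟩
  exact ⟨hs.range_eq ▸ isCompact_range hc⟩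

/-- Through this embedding the quotient topology inherits from matrices the properties needed for
weak convergence of measures. -/
theorem isClosedEmbedding_lineProj {d : ℕ} : IsClosedEmbedding (lineProj (d := d)) :=
  continuous_lineProj.isClosedEmbedding lineProj_injective

instance instT2SpaceRPd (d : ℕ) : T2Space (RPd d) :=
  isClosedEmbedding_lineProj.isEmbedding.t2Space

instance instSecondCountableTopologyRPd (d : ℕ) : SecondCountableTopology (RPd d) :=
  haveI : SecondCountableTopology (Matrix (Fin d) (Fin d) ℝ) :=
    inferInstanceAs (SecondCountableTopology (Fin d → Fin d → ℝ))
  isClosedEmbedding_lineProj.isEmbedding.secondCountableTopology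

instance instMetrizableSpaceRPd (d : ℕ) : TopologicalSpace.MetrizableSpace (RPd d) :=
  haveI : TopologicalSpace.MetrizableSpace (Matrix (Fin d) (Fin d) ℝ) :=
    inferInstanceAs (TopologicalSpace.MetrizableSpace (Fin d → Fin d → ℝ))
  isClosedEmbedding_lineProj.isEmbedding.metrizableSpace

theorem conj_lineProj {d : ℕ} (A : SLd d) (v : Fin d → ℝ) (hv : v ≠ 0) :
    (A : Matrix (Fin d) (Fin d) ℝ) * lineProj (Projectivization.mk ℝ v hv) *
      (A : Matrix (Fin d) (Fin d) ℝ).transpose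
      = (v ⬝ᵥ v)⁻¹ • Matrix.vecMulVec (A • v) (A • v) := by
  rw [lineProj_mk, Matrix.mul_smul, Matrix.smul_mul, Matrix.mul_vecMulVec, Matrix.vecMulVec_mul,
    Matrix.vecMul_transpose]
  rfl

theorem trace_conj_lineProj {d : ℕ} (A : SLd d) (v : Fin d → ℝ) (hv : v ≠ 0) :
    ((A : Matrix (Fin d) (Fin d) ℝ) * lineProj (Projectivization.mk ℝ v hv) *
      (A : Matrix (Fin d) (Fin d) ℝ).transpose).trace
      = (v ⬝ᵥ v)⁻¹ * ((A • v) ⬝ᵥ (A • v)) := by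
  rw [conj_lineProj, Matrix.trace_smul, Matrix.trace_vecMulVec, smul_eq_mul]

/-- With `P` the projection onto the line of `v`, the matrix `A P Aᵀ` is a positive multiple of the
projection onto the line of `A v`. Dividing by its trace therefore expresses the action by a formula
jointly continuous in both arguments. -/
theorem continuous_projMap_uncurry {d : ℕ} :
    Continuous (fun p : SLd d × RPd d => projMap p.1 p.2) := by
  rw [isClosedEmbedding_lineProj.isEmbedding.continuous_iff]
  have hne : ∀ (v : Fin d → ℝ), v ≠ 0 → v ⬝ᵥ v ≠ 0 := fun v hv => by simpa using hv
  have key : lineProj ∘ (fun p : SLd d × RPd d => projMap p.1 p.2) = fun p =>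
      ((p.1 : Matrix (Fin d) (Fin d) ℝ) * lineProj p.2 *
        (p.1 : Matrix (Fin d) (Fin d) ℝ).transpose).trace⁻¹ •
      ((p.1 : Matrix (Fin d) (Fin d) ℝ) * lineProj p.2 *
        (p.1 : Matrix (Fin d) (Fin d) ℝ).transpose) := by
    funext ⟨A, x⟩
    induction x using Projectivization.ind with | _ v hv
    have hAv : A • v ≠ 0 := (smul_ne_zero_iff_ne A).mpr hv
    change lineProj (Projectivization.mk ℝ (A • v) hAv) = _
    rw [trace_conj_lineProj, conj_lineProj, lineProj_mk, smul_smul]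
    congr 1
    have := hne v hv
    have := hne _ hAv
    field_simp
  have hc : Continuous fun p : SLd d × RPd d => (p.1 : Matrix (Fin d) (Fin d) ℝ) * lineProj p.2 *
        (p.1 : Matrix (Fin d) (Fin d) ℝ).transpose := by
    have h1 : Continuous fun p : SLd d × RPd d => (p.1 : Matrix (Fin d) (Fin d) ℝ) :=
      continuous_subtype_val.comp continuous_fst
    exact (h1.mul (continuous_lineProj.comp continuous_snd)).mul h1.matrix_transpose
  rw [key]
  refine (hc.matrix_trace.inv₀ ?_).smul hc
  rintro ⟨A, x⟩
  induction x using Projectivization.ind with | _ v hv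
  have hAv : A • v ≠ 0 := (smul_ne_zero_iff_ne A).mpr hv
  rw [trace_conj_lineProj]
  exact mul_ne_zero (inv_ne_zero (hne v hv)) (hne _ hAv)

/-! ### A quantitative, uniform form of the measures condition. -/

/-- The mean square deviation, in terms of the test function `h`, between `(f_A)_* ν₁` and `ν₂`. -/
noncomputable def discrepancy {d : ℕ} (h : C(RPd d, ℝ)) (μ : ProbabilityMeasure (SLd d))
    (ν₁ ν₂ : ProbabilityMeasure (RPd d)) : ℝ :=
  ∫ A, (∫ x, h (projMap A x) ∂(ν₁ : Measure (RPd d)) - ∫ y, h y ∂(ν₂ : Measure (RPd d))) ^ 2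
    ∂(μ : Measure (SLd d))

/-- The integrand whose integral over a product measure is the discrepancy. -/
noncomputable def discrepancyKernel {d : ℕ} (h : C(RPd d, ℝ)) :
    BoundedContinuousFunction (SLd d × ((RPd d × RPd d) × (RPd d × RPd d))) ℝ :=
  BoundedContinuousFunction.ofNormedAddCommGroup
    (fun p => (h (projMap p.1 p.2.1.1) - h p.2.1.2) * (h (projMap p.1 p.2.2.1) - h p.2.2.2))
    (by
      have h1 : Continuous fun p : SLd d × ((RPd d × RPd d) × (RPd d × RPd d)) =>
          projMap p.1 p.2.1.1 :=
        continuous_projMap_uncurry.comp (continuous_fst.prodMk (by fun_prop))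
      have h2 : Continuous fun p : SLd d × ((RPd d × RPd d) × (RPd d × RPd d)) =>
          projMap p.1 p.2.2.1 :=
        continuous_projMap_uncurry.comp (continuous_fst.prodMk (by fun_prop))
      fun_prop)
    ((‖h‖ + ‖h‖) * (‖h‖ + ‖h‖))
    (fun p => by
      rw [norm_mul]
      gcongr <;> exact (norm_sub_le _ _).trans (add_le_add (h.norm_coe_le_norm _)
        (h.norm_coe_le_norm _)))

theorem integrable_continuousMap {X : Type*} [TopologicalSpace X] [CompactSpace X]
    [MeasurableSpace X] [BorelSpace X] (h : C(X, ℝ)) (ν : Measure X) [IsFiniteMeasure ν] :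
    Integrable h ν :=
  (BoundedContinuousFunction.mkOfCompact h).integrable ν

/-- The square of an integral is an integral over two independent copies. This removes the
nonlinearity: one fixed bounded continuous function is integrated against a product measure, which
depends continuously on its factors. -/
theorem discrepancy_eq_integral_kernel {d : ℕ} (h : C(RPd d, ℝ)) (μ : ProbabilityMeasure (SLd d))
    (ν₁ ν₂ : ProbabilityMeasure (RPd d)) :
    discrepancy h μ ν₁ ν₂ = ∫ p, discrepancyKernel h p
      ∂(μ.prod ((ν₁.prod ν₂).prod (ν₁.prod ν₂)) : ProbabilityMeasure _) := by
  rw [ProbabilityMeasure.toMeasure_prod, integral_prod _ ((discrepancyKernel h).integrable _)]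
  unfold discrepancy
  congr 1
  funext A
  rw [ProbabilityMeasure.toMeasure_prod]
  change _ = ∫ p : (RPd d × RPd d) × (RPd d × RPd d),
    (h (projMap A p.1.1) - h p.1.2) * (h (projMap A p.2.1) - h p.2.2) ∂_
  rw [integral_prod_mul (fun p : RPd d × RPd d => h (projMap A p.1) - h p.2)
    (fun p : RPd d × RPd d => h (projMap A p.1) - h p.2), ← pow_two]
  congr 1
  have i1 : Integrable (fun x => h (projMap A x)) (ν₁ : Measure (RPd d)) :=
    integrable_continuousMap (h.comp ⟨projMap A, continuous_projMap A⟩) _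
  have i2 : Integrable h (ν₂ : Measure (RPd d)) := integrable_continuousMap h _
  rw [ProbabilityMeasure.toMeasure_prod, integral_sub (i1.comp_fst _) (i2.comp_snd _),
    integral_fun_fst (fun x => h (projMap A x)), integral_fun_snd h]
  simp

theorem continuous_discrepancy {d : ℕ} (h : C(RPd d, ℝ)) :
    Continuous fun p : ProbabilityMeasure (SLd d) × ProbabilityMeasure (RPd d) ×
      ProbabilityMeasure (RPd d) => discrepancy h p.1 p.2.1 p.2.2 := by
  simp_rw [discrepancy_eq_integral_kernel]
  refine (ProbabilityMeasure.continuous_integral_boundedContinuousFunction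
    (discrepancyKernel h)).comp ?_
  have h1 : Continuous fun p : ProbabilityMeasure (SLd d) × ProbabilityMeasure (RPd d) ×
      ProbabilityMeasure (RPd d) => p.2.1.prod p.2.2 :=
    ProbabilityMeasure.continuous_prod.comp continuous_snd
  exact ProbabilityMeasure.continuous_prod.comp
    (continuous_fst.prodMk (ProbabilityMeasure.continuous_prod.comp (h1.prodMk h1)))

theorem continuous_integral_continuousMap {X : Type*} [TopologicalSpace X] [CompactSpace X]
    [MeasurableSpace X] [BorelSpace X] (ν : Measure X) [IsProbabilityMeasure ν] :
    Continuous fun h : C(X, ℝ) => ∫ x, h x ∂ν := by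
  refine LipschitzWith.continuous (K := 1) (LipschitzWith.of_dist_le_mul fun f g => ?_)
  rw [dist_eq_norm, dist_eq_norm,
    ← integral_sub (integrable_continuousMap f ν) (integrable_continuousMap g ν)]
  have := norm_integral_le_of_norm_le_const (μ := ν) (f := fun x => f x - g x) (C := ‖f - g‖)
    (ae_of_all _ fun x => (f - g).norm_coe_le_norm x)
  simpa using this

theorem continuous_integral_projMap {d : ℕ} (h : C(RPd d, ℝ)) (ν : ProbabilityMeasure (RPd d)) :
    Continuous fun A : SLd d => ∫ x, h (projMap A x) ∂(ν : Measure (RPd d)) := by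
  refine continuous_of_dominated (bound := fun _ => ‖h‖) (fun A => ?_)
    (fun A => ae_of_all _ fun x => h.norm_coe_le_norm _) (integrable_const _)
    (ae_of_all _ fun x => ?_)
  · exact (h.continuous.comp (continuous_projMap A)).aestronglyMeasurable
  · exact h.continuous.comp (continuous_projMap_uncurry.comp
      (continuous_id.prodMk continuous_const))

theorem abs_integral_continuousMap_le {X Y : Type*} [TopologicalSpace X] [CompactSpace X]
    [MeasurableSpace Y] (h : C(X, ℝ)) (f : Y → X) (ν : Measure Y) [IsProbabilityMeasure ν] :
    |∫ y, h (f y) ∂ν| ≤ ‖h‖ := by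
  simpa using norm_integral_le_of_norm_le_const (μ := ν) (f := fun y => h (f y)) (C := ‖h‖)
    (ae_of_all _ fun x => h.norm_coe_le_norm _)

theorem integrable_sq_deviation {d : ℕ} (h : C(RPd d, ℝ)) (μ : ProbabilityMeasure (SLd d))
    (ν₁ ν₂ : ProbabilityMeasure (RPd d)) :
    Integrable (fun A => (∫ x, h (projMap A x) ∂(ν₁ : Measure (RPd d)) -
      ∫ y, h y ∂(ν₂ : Measure (RPd d))) ^ 2) (μ : Measure (SLd d)) := by
  refine Integrable.of_bound (((continuous_integral_projMap h ν₁).sub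
    continuous_const).pow 2).aestronglyMeasurable ((‖h‖ + ‖h‖) ^ 2) (ae_of_all _ fun A => ?_)
  rw [norm_pow]
  gcongr
  exact (norm_sub_le _ _).trans (add_le_add (abs_integral_continuousMap_le h _ _)
    (abs_integral_continuousMap_le h _ _))

/-- If every discrepancy vanished, each `h` would give equal integrals outside a null set depending
on `h`. A countable dense set of test functions makes the null set common, and then the two measures
coincide. -/
theorem exists_discrepancy_pos {d : ℕ} {μ : ProbabilityMeasure (SLd d)} (hμ : MeasuresCondition μ)
    (ν₁ ν₂ : ProbabilityMeasure (RPd d)) : ∃ h, 0 < discrepancy h μ ν₁ ν₂ := by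
  by_contra! hcon
  refine hμ ⟨ν₁, ν₂, ?_⟩
  have hae : ∀ h : C(RPd d, ℝ), ∀ᵐ A ∂(μ : Measure (SLd d)),
      ∫ x, h (projMap A x) ∂(ν₁ : Measure (RPd d)) = ∫ y, h y ∂(ν₂ : Measure (RPd d)) := by
    intro h
    have h0 : discrepancy h μ ν₁ ν₂ = 0 :=
      le_antisymm (hcon h) (integral_nonneg fun A => sq_nonneg _)
    have := (integral_eq_zero_iff_of_nonneg (fun A => sq_nonneg _)
      (integrable_sq_deviation h μ ν₁ ν₂)).1 h0
    filter_upwards [this] with A hA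
    exact sub_eq_zero.1 (pow_eq_zero_iff two_ne_zero |>.1 hA)
  obtain ⟨s, hsc, hsd⟩ := TopologicalSpace.exists_countable_dense C(RPd d, ℝ)
  filter_upwards [(ae_ball_iff hsc).2 fun h _ => hae h] with A hA
  have hm := measurable_projMap A
  have : IsProbabilityMeasure (Measure.map (projMap A) (ν₁ : Measure (RPd d))) :=
    Measure.isProbabilityMeasure_map hm.aemeasurable
  have hall : (fun h : C(RPd d, ℝ) => ∫ x, h x ∂(Measure.map (projMap A) (ν₁ : Measure (RPd d))))
      = fun h : C(RPd d, ℝ) => ∫ x, h x ∂(ν₂ : Measure (RPd d)) := by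
    refine Continuous.ext_on hsd (continuous_integral_continuousMap _)
      (continuous_integral_continuousMap _) fun h hh => ?_
    rw [integral_map hm.aemeasurable h.continuous.aestronglyMeasurable]
    exact hA h hh
  exact ext_of_forall_integral_eq_of_IsFiniteMeasure fun f => congrFun hall f.toContinuousMap

theorem exists_uniform_discrepancy {d : ℕ} {K : Set (ProbabilityMeasure (SLd d))}
    (hK : IsCompact K) (hmeas : ∀ μ ∈ K, MeasuresCondition μ) :
    ∃ ε > 0, ∃ C > 0, ∀ μ ∈ K, ∀ ν₁ ν₂, ∃ h : C(RPd d, ℝ), ‖h‖ ≤ C ∧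
      ε ≤ discrepancy h μ ν₁ ν₂ := by
  have hc : IsCompact (K ×ˢ (Set.univ : Set (ProbabilityMeasure (RPd d) ×
      ProbabilityMeasure (RPd d)))) := hK.prod isCompact_univ
  -- Each point of the compact set has its own test function, valid nearby by continuity. A finite
  -- subcover leaves finitely many, so their norms are bounded and their discrepancies bounded
  -- below.
  have := hc.induction_on
    (p := fun S => ∃ ε > 0, ∃ C > 0, ∀ p ∈ S, ∃ h : C(RPd d, ℝ), ‖h‖ ≤ C ∧
      ε ≤ discrepancy h p.1 p.2.1 p.2.2)
    ⟨1, one_pos, 1, one_pos, by simp⟩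
    (fun S T hST ⟨ε, hε, C, hC, hT⟩ => ⟨ε, hε, C, hC, fun p hp => hT p (hST hp)⟩)
    ?_ ?_
  · obtain ⟨ε, hε, C, hC, H⟩ := this
    exact ⟨ε, hε, C, hC, fun μ hμ ν₁ ν₂ => H (μ, ν₁, ν₂) ⟨hμ, trivial⟩⟩
  · rintro S T ⟨ε, hε, C, hC, hS⟩ ⟨ε', hε', C', hC', hT⟩
    refine ⟨min ε ε', lt_min hε hε', max C C', lt_max_of_lt_left hC, ?_⟩
    rintro p (hp | hp)
    · obtain ⟨h, h1, h2⟩ := hS p hp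
      exact ⟨h, h1.trans (le_max_left _ _), (min_le_left _ _).trans h2⟩
    · obtain ⟨h, h1, h2⟩ := hT p hp
      exact ⟨h, h1.trans (le_max_right _ _), (min_le_right _ _).trans h2⟩
  · rintro ⟨μ, ν₁, ν₂⟩ ⟨hμ, -⟩
    obtain ⟨h, hh⟩ := exists_discrepancy_pos (hmeas μ hμ) ν₁ ν₂
    refine ⟨{p | discrepancy h μ ν₁ ν₂ / 2 < discrepancy h p.1 p.2.1 p.2.2},
      mem_nhdsWithin_of_mem_nhds ?_, discrepancy h μ ν₁ ν₂ / 2, half_pos hh, ‖h‖ + 1,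
      by positivity, fun p hp => ⟨h, by linarith, le_of_lt hp⟩⟩
    exact (isOpen_lt continuous_const (continuous_discrepancy h)).mem_nhds (half_lt_self hh)

/-! ### Lebesgue measure under the action, and laws of random lines. -/

theorem measurePreserving_smul_volume {d : ℕ} (A : SLd d) :
    MeasurePreserving (fun v : Fin d → ℝ => A • v) volume volume where
  measurable := (continuous_const_smul A).measurable
  map_eq := by
    have h := Real.map_matrix_volume_pi_eq_smul_volume_pi
      (M := (A : Matrix (Fin d) (Fin d) ℝ)) (by simp)
    rw [A.det_coe, inv_one, abs_one, ENNReal.ofReal_one, one_smul] at h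
    exact h

theorem integral_smul_volume {d : ℕ} (A : SLd d) (f : (Fin d → ℝ) → ℝ) :
    ∫ v, f (A • v) = ∫ v, f v :=
  (measurePreserving_smul_volume A).integral_comp
    (Homeomorph.smul A).measurableEmbedding f

theorem integrable_smul_volume {d : ℕ} (A : SLd d) {f : (Fin d → ℝ) → ℝ} (hf : Integrable f) :
    Integrable fun v => f (A • v) :=
  (measurePreserving_smul_volume A).integrable_comp_of_integrable hf

/-- The line spanned by a vector, with an arbitrary value at the zero vector. -/
noncomputable def toLine {d : ℕ} [NeZero d] (v : Fin d → ℝ) : RPd d :=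
  open Classical in
  if h : v ≠ 0 then Projectivization.mk ℝ v h else Projectivization.mk ℝ 1 one_ne_zero

theorem toLine_of_ne_zero {d : ℕ} [NeZero d] {v : Fin d → ℝ} (h : v ≠ 0) :
    toLine v = Projectivization.mk ℝ v h := dif_pos h

theorem measurable_toLine {d : ℕ} [NeZero d] : Measurable (toLine (d := d)) := by
  refine measurable_of_measurable_on_compl_singleton 0 ?_
  have : Set.domRestrict {x : Fin d → ℝ | x ≠ 0} toLine =
      fun v : {v : Fin d → ℝ // v ≠ 0} => (Projectivization.mk ℝ v.1 v.2 : RPd d) := by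
    funext v
    exact toLine_of_ne_zero v.2
  rw [this]
  exact continuous_mk.measurable

theorem projMap_toLine {d : ℕ} [NeZero d] (A : SLd d) {v : Fin d → ℝ} (h : v ≠ 0) :
    projMap A (toLine v) = toLine (A • v) := by
  rw [toLine_of_ne_zero h, toLine_of_ne_zero ((smul_ne_zero_iff_ne A).mpr h)]
  rfl

/-- The law on the projective space of the line spanned by a random vector of density `φ ^ 2`. -/
noncomputable def lineLaw {d : ℕ} [NeZero d] (φ : (Fin d → ℝ) → ℝ) : Measure (RPd d) :=
  (volume.withDensity fun v => ENNReal.ofReal (φ v ^ 2)).map toLine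

theorem isProbabilityMeasure_lineLaw {d : ℕ} [NeZero d] {φ : (Fin d → ℝ) → ℝ}
    (hi : Integrable fun v => φ v ^ 2) (h1 : ∫ v, φ v ^ 2 = 1) :
    IsProbabilityMeasure (lineLaw φ) := by
  have : IsProbabilityMeasure (volume.withDensity fun v => ENNReal.ofReal (φ v ^ 2)) := by
    constructor
    rw [withDensity_apply _ MeasurableSet.univ, Measure.restrict_univ,
      ← ofReal_integral_eq_lintegral_ofReal hi (ae_of_all _ fun v => sq_nonneg _), h1,
      ENNReal.ofReal_one]
  exact Measure.isProbabilityMeasure_map measurable_toLine.aemeasurable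

theorem integral_lineLaw {d : ℕ} [NeZero d] {φ : (Fin d → ℝ) → ℝ} (hφ : Measurable φ)
    (h : C(RPd d, ℝ)) : ∫ x, h x ∂(lineLaw φ) = ∫ v, h (toLine v) * φ v ^ 2 := by
  rw [lineLaw, integral_map measurable_toLine.aemeasurable h.continuous.aestronglyMeasurable,
    integral_withDensity_eq_integral_toReal_smul (hφ.pow_const 2).ennreal_ofReal
      (ae_of_all _ fun _ => ENNReal.ofReal_lt_top)]
  congr 1
  funext v
  rw [ENNReal.toReal_ofReal (sq_nonneg _), smul_eq_mul, mul_comm]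

/-! ### From correlations in `L²` to the spectral gap. -/

/-- Two unit vectors of `L²` with inner product near `1` have squares that are close in `L¹`. -/
theorem sq_integral_mul_sq_sub_sq_le {α : Type*} [MeasurableSpace α] {m : Measure α}
    {u v H : α → ℝ} {C : ℝ} (hC : 0 < C) (hu : MemLp u 2 m) (hv : MemLp v 2 m)
    (hu1 : ∫ x, u x ^ 2 ∂m = 1) (hv1 : ∫ x, v x ^ 2 ∂m = 1) (hH : ∀ x, |H x| ≤ C) :
    (∫ x, H x * (v x ^ 2 - u x ^ 2) ∂m) ^ 2 ≤ 8 * C ^ 2 * (1 - ∫ x, u x * v x ∂m) := by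
  have iu := hu.integrable_sq
  have iv := hv.integrable_sq
  have iuv : Integrable (fun x => u x * v x) m := hu.integrable_mul hv
  have isum : Integrable (fun x => u x ^ 2 + v x ^ 2) m := iu.add iv
  set s := ∫ x, u x * v x ∂m
  have hminus : ∫ x, (u x - v x) ^ 2 ∂m = 2 - 2 * s := by
    have : (fun x => (u x - v x) ^ 2) = fun x => (u x ^ 2 + v x ^ 2) - 2 * (u x * v x) := by
      funext x; ring
    rw [this, integral_sub isum (iuv.const_mul 2), integral_add iu iv, integral_const_mul,
      hu1, hv1]
    ring
  have hplus : ∫ x, (u x + v x) ^ 2 ∂m = 2 + 2 * s := by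
    have : (fun x => (u x + v x) ^ 2) = fun x => (u x ^ 2 + v x ^ 2) + 2 * (u x * v x) := by
      funext x; ring
    rw [this, integral_add isum (iuv.const_mul 2), integral_add iu iv, integral_const_mul,
      hu1, hv1]
    ring
  have hs1 : s ≤ 1 := by
    have : 0 ≤ ∫ x, (u x - v x) ^ 2 ∂m := integral_nonneg fun x => sq_nonneg _
    linarith
  have iminus : Integrable (fun x => (u x - v x) ^ 2) m := (hu.sub hv).integrable_sq
  have iplus : Integrable (fun x => (u x + v x) ^ 2) m := (hu.add hv).integrable_sq
  -- Cauchy–Schwarz for `|u - v| |u + v|`, in the form of the weighted inequality `2ab ≤ t a² + b² /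
  -- t`.
  have key : ∀ t : ℝ, 0 < t → |∫ x, H x * (v x ^ 2 - u x ^ 2) ∂m| ≤
      C * (t * (1 - s) + t⁻¹ * 2) := by
    intro t ht
    have hbd : |∫ x, H x * (v x ^ 2 - u x ^ 2) ∂m| ≤
        ∫ x, C * (t / 2 * (u x - v x) ^ 2 + t⁻¹ / 2 * (u x + v x) ^ 2) ∂m := by
      have hi : Integrable (fun x => t / 2 * (u x - v x) ^ 2 + t⁻¹ / 2 * (u x + v x) ^ 2) m :=
        (iminus.const_mul _).add (iplus.const_mul _)
      rw [← Real.norm_eq_abs]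
      refine norm_integral_le_of_norm_le (hi.const_mul C) (ae_of_all _ fun x => ?_)
      rw [Real.norm_eq_abs, abs_mul]
      refine mul_le_mul (hH x) ?_ (abs_nonneg _) hC.le
      have h1 : t / 2 * (u x - v x) ^ 2 + t⁻¹ / 2 * (u x + v x) ^ 2 - |v x ^ 2 - u x ^ 2| =
          t⁻¹ / 2 * (t * |u x - v x| - |u x + v x|) ^ 2 := by
        have : |v x ^ 2 - u x ^ 2| = |u x - v x| * |u x + v x| := by
          rw [← abs_mul, ← abs_neg]; ring_nf
        rw [this, ← sq_abs (u x - v x), ← sq_abs (u x + v x)]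
        field_simp
        ring
      have h2 : 0 ≤ t⁻¹ / 2 * (t * |u x - v x| - |u x + v x|) ^ 2 := by positivity
      linarith
    rw [integral_const_mul, integral_add (iminus.const_mul _) (iplus.const_mul _),
      integral_const_mul, integral_const_mul, hminus, hplus] at hbd
    refine hbd.trans (mul_le_mul_of_nonneg_left ?_ hC.le)
    have : t⁻¹ * s ≤ t⁻¹ * 1 := mul_le_mul_of_nonneg_left hs1 (by positivity)
    linarith
  set D := ∫ x, H x * (v x ^ 2 - u x ^ 2) ∂m
  rcases (abs_nonneg D).eq_or_lt with h0 | h0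
  · rw [← sq_abs, ← h0]
    have : 0 ≤ 1 - s := by linarith
    nlinarith [mul_nonneg (sq_nonneg C) this]
  -- This `t` makes the second term equal to `|D| / 2`, which the left side absorbs.
  · have := key (4 * C / |D|) (by positivity)
    have e : C * (4 * C / |D| * (1 - s) + (4 * C / |D|)⁻¹ * 2) =
        4 * C ^ 2 * (1 - s) / |D| + |D| / 2 := by
      field_simp
      ring
    rw [e] at this
    have h3 : |D| / 2 ≤ 4 * C ^ 2 * (1 - s) / |D| := by linarith
    rw [le_div_iff₀ h0] at h3
    rw [← sq_abs]
    linarith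

theorem measurable_smul_uncurry {d : ℕ} :
    Measurable fun p : SLd d × (Fin d → ℝ) => p.1 • p.2 :=
  continuous_smul.measurable

theorem memLp_two_of_integrable_sq {d : ℕ} {φ : (Fin d → ℝ) → ℝ} (hφ : Measurable φ)
    (hi : Integrable fun v => φ v ^ 2) : MemLp φ 2 :=
  (memLp_two_iff_integrable_sq hφ.aestronglyMeasurable).2 hi

/-- The substitution `v ↦ A v` in the integral for `φ` makes both integrals use the same function `h
(toLine (A • v))`, with weights `ψ²` and `(φ ∘ A)²`. The `L¹` comparison of squares then applies. -/
theorem sq_deviation_le {d : ℕ} [NeZero d] {φ ψ : (Fin d → ℝ) → ℝ}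
    (hφ : Measurable φ) (hψ : Measurable ψ)
    (hφi : Integrable fun v => φ v ^ 2) (hψi : Integrable fun v => ψ v ^ 2)
    (hφ1 : ∫ v, φ v ^ 2 = 1) (hψ1 : ∫ v, ψ v ^ 2 = 1) {C : ℝ} (hC : 0 < C) {h : C(RPd d, ℝ)}
    (hh : ‖h‖ ≤ C) (A : SLd d) :
    (∫ x, h (projMap A x) ∂(lineLaw ψ) - ∫ y, h y ∂(lineLaw φ)) ^ 2 ≤
      8 * C ^ 2 * (1 - ∫ v, φ (A • v) * ψ v) := by
  have hAi := integrable_smul_volume A hφi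
  have hAm : Measurable fun v => φ (A • v) := hφ.comp (continuous_const_smul A).measurable
  have e1 : ∫ x, h (projMap A x) ∂(lineLaw ψ) = ∫ v, h (toLine (A • v)) * ψ v ^ 2 := by
    rw [show (fun x => h (projMap A x)) = (h.comp ⟨projMap A, continuous_projMap A⟩ : C(RPd d, ℝ))
      from rfl, integral_lineLaw hψ]
    refine integral_congr_ae ?_
    have : ∀ᵐ v : Fin d → ℝ, v ≠ 0 := by simp [ae_iff]
    filter_upwards [this] with v hv
    simp [projMap_toLine A hv]
  have e2 : ∫ y, h y ∂(lineLaw φ) = ∫ v, h (toLine (A • v)) * φ (A • v) ^ 2 := by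
    rw [integral_lineLaw hφ]
    exact (integral_smul_volume A fun v => h (toLine v) * φ v ^ 2).symm
  have hb : ∀ v, |h (toLine (A • v))| ≤ C := fun v => (h.norm_coe_le_norm _).trans hh
  have hm : Measurable fun v => h (toLine (A • v)) :=
    h.continuous.measurable.comp (measurable_toLine.comp (continuous_const_smul A).measurable)
  rw [e1, e2, ← integral_sub (hψi.bdd_mul hm.aestronglyMeasurable (ae_of_all _ hb))
    (hAi.bdd_mul hm.aestronglyMeasurable (ae_of_all _ hb))]
  simp_rw [← mul_sub]
  refine sq_integral_mul_sq_sub_sq_le hC (memLp_two_of_integrable_sq hAm hAi)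
    (memLp_two_of_integrable_sq hψ hψi) ?_ hψ1 hb
  rw [integral_smul_volume A fun v => φ v ^ 2, hφ1]

theorem abs_integral_mul_le_one {α : Type*} [MeasurableSpace α] {m : Measure α}
    {u v : α → ℝ} (hu : MemLp u 2 m) (hv : MemLp v 2 m)
    (hu1 : ∫ x, u x ^ 2 ∂m = 1) (hv1 : ∫ x, v x ^ 2 ∂m = 1) :
    |∫ x, u x * v x ∂m| ≤ 1 := by
  have : |∫ x, u x * v x ∂m| ≤ ∫ x, (2⁻¹ * u x ^ 2 + 2⁻¹ * v x ^ 2) ∂m := by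
    have hi : Integrable (fun x => 2⁻¹ * u x ^ 2 + 2⁻¹ * v x ^ 2) m :=
      (hu.integrable_sq.const_mul _).add (hv.integrable_sq.const_mul _)
    rw [← Real.norm_eq_abs]
    refine norm_integral_le_of_norm_le hi (ae_of_all _ fun x => ?_)
    rw [Real.norm_eq_abs, abs_le]
    constructor <;> nlinarith [sq_nonneg (u x - v x), sq_nonneg (u x + v x)]
  rw [integral_add (hu.integrable_sq.const_mul _) (hv.integrable_sq.const_mul _),
    integral_const_mul, integral_const_mul, hu1, hv1] at this
  linarith

theorem integrable_correlation {d : ℕ} {φ ψ : (Fin d → ℝ) → ℝ}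
    (hφ : Measurable φ) (hψ : Measurable ψ)
    (hφi : Integrable fun v => φ v ^ 2) (hψi : Integrable fun v => ψ v ^ 2)
    (hφ1 : ∫ v, φ v ^ 2 = 1) (hψ1 : ∫ v, ψ v ^ 2 = 1) (μ : ProbabilityMeasure (SLd d)) :
    Integrable (fun A => ∫ v, φ (A • v) * ψ v) (μ : Measure (SLd d)) := by
  have hm : Measurable fun p : SLd d × (Fin d → ℝ) => φ (p.1 • p.2) * ψ p.2 :=
    (hφ.comp measurable_smul_uncurry).mul (hψ.comp measurable_snd)
  refine Integrable.of_bound hm.stronglyMeasurable.integral_prod_right.aestronglyMeasurable 1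
    (ae_of_all _ fun A => ?_)
  refine abs_integral_mul_le_one (memLp_two_of_integrable_sq
    (hφ.comp (continuous_const_smul A).measurable) (integrable_smul_volume A hφi))
    (memLp_two_of_integrable_sq hψ hψi) ?_ hψ1
  rw [integral_smul_volume A fun v => φ v ^ 2, hφ1]

/-- Uniform spectral gap for the averaged Koopman operators on `L²(ℝ^d)`, for unit vectors. -/
theorem exists_gap_unit {d : ℕ} [NeZero d] {K : Set (ProbabilityMeasure (SLd d))}
    (hK : IsCompact K) (hmeas : ∀ μ ∈ K, MeasuresCondition μ) :
    ∃ q : ℝ, 0 < q ∧ q < 1 ∧ ∀ μ ∈ K, ∀ φ ψ : (Fin d → ℝ) → ℝ, Measurable φ → Measurable ψ →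
      (Integrable fun v => φ v ^ 2) → (Integrable fun v => ψ v ^ 2) →
      ∫ v, φ v ^ 2 = 1 → ∫ v, ψ v ^ 2 = 1 →
      ∫ A, (∫ v, φ (A • v) * ψ v) ∂(μ : Measure (SLd d)) ≤ q := by
  obtain ⟨ε, hε, C, hC, H⟩ := exists_uniform_discrepancy hK hmeas
  -- The second entry solves `ε ≤ 8 C² (1 - correlation)`; the first only keeps `q` positive, so
  -- that its logarithm can be used.
  refine ⟨max (1 / 2) (1 - ε / (8 * C ^ 2)), lt_max_of_lt_left (by norm_num),
    max_lt (by norm_num) (sub_lt_self _ (by positivity)), ?_⟩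
  intro μ hμ φ ψ hφ hψ hφi hψi hφ1 hψ1
  refine le_trans ?_ (le_max_right _ _)
  -- The source is `ψ` and the target `φ`: if `φ ∘ A = ψ`, then `A` moves the density `ψ²` to `φ²`.
  obtain ⟨h, hhC, hh⟩ := H μ hμ ⟨lineLaw ψ, isProbabilityMeasure_lineLaw hψi hψ1⟩
    ⟨lineLaw φ, isProbabilityMeasure_lineLaw hφi hφ1⟩
  have hI := integrable_correlation hφ hψ hφi hψi hφ1 hψ1 μ
  have hle := hh.trans (integral_mono (integrable_sq_deviation h μ _ _)
    (((integrable_const 1).sub hI).const_mul (8 * C ^ 2))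
    fun A => sq_deviation_le hφ hψ hφi hψi hφ1 hψ1 hC hhC A)
  simp only [Pi.sub_apply] at hle
  rw [integral_const_mul, integral_sub (integrable_const 1) hI] at hle
  simp only [integral_const, probReal_univ, smul_eq_mul, mul_one] at hle
  rw [mul_comm, ← div_le_iff₀ (by positivity)] at hle
  linarith

/-! ### Averaged Koopman operators and their contraction. -/

/-- Integrable functions on `ℝ^d` with values in `[0, 1]`. -/
structure IsTestFunction {d : ℕ} (g : (Fin d → ℝ) → ℝ) : Prop where
  measurable : Measurable g
  nonneg : ∀ v, 0 ≤ g v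
  le_one : ∀ v, g v ≤ 1
  integrable : Integrable g

/-- The averaged Koopman operator of a law on `SL(d, ℝ)`. -/
noncomputable def koopman {d : ℕ} (μ : ProbabilityMeasure (SLd d)) (g : (Fin d → ℝ) → ℝ)
    (v : Fin d → ℝ) : ℝ :=
  ∫ A, g (A • v) ∂(μ : Measure (SLd d))

namespace IsTestFunction

variable {d : ℕ} {g : (Fin d → ℝ) → ℝ}

theorem norm_le_one (hg : IsTestFunction g) (v : Fin d → ℝ) : ‖g v‖ ≤ 1 := by
  rw [Real.norm_of_nonneg (hg.nonneg v)]
  exact hg.le_one v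

theorem integrable_sq (hg : IsTestFunction g) : Integrable fun v => g v ^ 2 := by
  simp_rw [pow_two]
  exact hg.integrable.bdd_mul hg.measurable.aestronglyMeasurable (ae_of_all _ hg.norm_le_one)

theorem measurable_smul (hg : IsTestFunction g) :
    Measurable fun p : SLd d × (Fin d → ℝ) => g (p.1 • p.2) :=
  hg.measurable.comp measurable_smul_uncurry

theorem integrable_smul_prod (hg : IsTestFunction g) (μ : ProbabilityMeasure (SLd d)) :
    Integrable (fun p : SLd d × (Fin d → ℝ) => g (p.1 • p.2))
      ((μ : Measure (SLd d)).prod volume) := by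
  rw [integrable_prod_iff hg.measurable_smul.aestronglyMeasurable]
  refine ⟨ae_of_all _ fun A => integrable_smul_volume A hg.integrable, ?_⟩
  have : (fun A : SLd d => ∫ v, ‖g (A • v)‖) = fun _ => ∫ v, ‖g v‖ := by
    funext A
    exact integral_smul_volume A fun v => ‖g v‖
  simp only [this]
  exact integrable_const _

theorem integrable_orbit (hg : IsTestFunction g) (μ : ProbabilityMeasure (SLd d))
    (v : Fin d → ℝ) : Integrable (fun A : SLd d => g (A • v)) (μ : Measure (SLd d)) :=
  Integrable.of_bound (hg.measurable_smul.comp measurable_prodMk_right).aestronglyMeasurable 1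
    (ae_of_all _ fun _ => hg.norm_le_one _)

/-- Stability of the class under averaging is what allows the contraction to be iterated. -/
protected theorem koopman (hg : IsTestFunction g) (μ : ProbabilityMeasure (SLd d)) :
    IsTestFunction (koopman μ g) where
  measurable := hg.measurable_smul.stronglyMeasurable.integral_prod_left.measurable
  nonneg v := integral_nonneg fun A => hg.nonneg _
  le_one v := by
    refine (integral_mono (hg.integrable_orbit μ v) (integrable_const 1)
      fun A => hg.le_one _).trans ?_
    simp
  integrable := (hg.integrable_smul_prod μ).integral_prod_right

theorem integral_koopman (hg : IsTestFunction g) (μ : ProbabilityMeasure (SLd d)) :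
    ∫ v, koopman μ g v = ∫ v, g v := by
  unfold koopman
  rw [← integral_integral_swap (f := fun (A : SLd d) v => g (A • v)) (hg.integrable_smul_prod μ)]
  simp_rw [integral_smul_volume _ g]
  simp

theorem integral_correlation (hg : IsTestFunction g) {f : (Fin d → ℝ) → ℝ}
    (hf : IsTestFunction f) (μ : ProbabilityMeasure (SLd d)) :
    ∫ A, (∫ v, g (A • v) * f v) ∂(μ : Measure (SLd d)) = ∫ v, koopman μ g v * f v := by
  rw [integral_integral_swap]
  · simp_rw [integral_mul_const]
    rfl
  · exact (hg.integrable_smul_prod μ).mul_bdd (c := 1)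
      (hf.measurable.comp measurable_snd).aestronglyMeasurable
      (ae_of_all _ fun p => hf.norm_le_one _)

end IsTestFunction

/-- Uniform contraction in `L²(ℝ^d)` of the averaged Koopman operators. -/
theorem exists_koopman_gap {d : ℕ} [NeZero d] {K : Set (ProbabilityMeasure (SLd d))}
    (hK : IsCompact K) (hmeas : ∀ μ ∈ K, MeasuresCondition μ) :
    ∃ q : ℝ, 0 < q ∧ q < 1 ∧ ∀ μ ∈ K, ∀ g : (Fin d → ℝ) → ℝ, IsTestFunction g →
      ∫ v, koopman μ g v ^ 2 ≤ q ^ 2 * ∫ v, g v ^ 2 := by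
  obtain ⟨q, hq0, hq1, H⟩ := exists_gap_unit hK hmeas
  refine ⟨q, hq0, hq1, fun μ hμ g hg => ?_⟩
  have hf := hg.koopman μ
  set f := koopman μ g with hfdef
  have ha0 : 0 ≤ ∫ v, g v ^ 2 := integral_nonneg fun v => sq_nonneg _
  have hb0 : 0 ≤ ∫ v, f v ^ 2 := integral_nonneg fun v => sq_nonneg _
  rcases hb0.eq_or_lt with hb | hb
  · rw [← hb]
    positivity
  rcases ha0.eq_or_lt with ha | ha
  -- If `g` vanishes almost everywhere, then `∫ f² ≤ ∫ f = ∫ g = 0`, against `0 < ∫ f²`.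
  · exfalso
    have hg0 := (integral_eq_zero_iff_of_nonneg (fun v => sq_nonneg _) hg.integrable_sq).1 ha.symm
    have hgi : ∫ v, g v = 0 := by
      refine integral_eq_zero_of_ae ?_
      filter_upwards [hg0] with v hv
      exact pow_eq_zero_iff two_ne_zero |>.1 hv
    have hle : ∫ v, f v ^ 2 ≤ ∫ v, f v := integral_mono hf.integrable_sq hf.integrable fun v =>
      pow_le_of_le_one (hf.nonneg v) (hf.le_one v) two_ne_zero
    rw [hfdef, hg.integral_koopman μ, hgi] at hle
    exact absurd hb (not_lt.2 hle)
  set a := ∫ v, g v ^ 2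
  set b := ∫ v, f v ^ 2 with hbdef
  have hsa : 0 < √a := Real.sqrt_pos.2 ha
  have hsb : 0 < √b := Real.sqrt_pos.2 hb
  -- Pairing `g` with its own image `f`, both normalised, turns the averaged correlation into the
  -- ratio `√b / √a` of their norms.
  have hgap := H μ hμ (fun v => (√a)⁻¹ * g v) (fun v => (√b)⁻¹ * f v)
    (hg.measurable.const_mul _) (hf.measurable.const_mul _)
    (by simp_rw [mul_pow]; exact hg.integrable_sq.const_mul _)
    (by simp_rw [mul_pow]; exact hf.integrable_sq.const_mul _)
    (by
      simp_rw [mul_pow]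
      rw [integral_const_mul, inv_pow, Real.sq_sqrt ha.le]
      exact inv_mul_cancel₀ ha.ne')
    (by
      simp_rw [mul_pow]
      rw [integral_const_mul, inv_pow, Real.sq_sqrt hb.le]
      exact inv_mul_cancel₀ hb.ne')
  have e : ∫ A, (∫ v, (√a)⁻¹ * g (A • v) * ((√b)⁻¹ * f v)) ∂(μ : Measure (SLd d)) =
      ((√a)⁻¹ * (√b)⁻¹) * b := by
    have : ∀ (A : SLd d) v, (√a)⁻¹ * g (A • v) * ((√b)⁻¹ * f v) =
        ((√a)⁻¹ * (√b)⁻¹) * (g (A • v) * f v) := fun A v => by ring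
    simp_rw [this, integral_const_mul]
    rw [hg.integral_correlation hf μ, ← hfdef, hbdef]
    simp_rw [pow_two]
  rw [e] at hgap
  have h1 : √b ≤ q * √a := by
    have h2 : ((√a)⁻¹ * (√b)⁻¹) * b = √b / √a := by
      nth_rewrite 2 [← Real.mul_self_sqrt hb.le]
      field_simp
    rwa [h2, div_le_iff₀ hsa] at hgap
  calc b = √b ^ 2 := (Real.sq_sqrt hb.le).symm
    _ ≤ (q * √a) ^ 2 := by gcongr
    _ = q ^ 2 * a := by rw [mul_pow, Real.sq_sqrt ha.le]

/-! ### Independent products and composition of operators. -/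

theorem orderedProduct_cons {d n : ℕ} (A : SLd d) (B : Fin n → SLd d) :
    orderedProduct (Fin.cons A B : Fin (n + 1) → SLd d) = orderedProduct B * A := by
  simp [orderedProduct, List.ofFn_succ]

theorem orderedProduct_succ {d n : ℕ} (A : Fin (n + 1) → SLd d) :
    orderedProduct A = orderedProduct (fun i : Fin n => A i.succ) * A 0 := by
  simp [orderedProduct, List.ofFn_succ]

theorem continuous_orderedProduct {d : ℕ} :
    ∀ n, Continuous (orderedProduct : (Fin n → SLd d) → SLd d)
  | 0 => by
    have : (orderedProduct : (Fin 0 → SLd d) → SLd d) = fun _ => 1 := by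
      funext A; simp [orderedProduct]
    rw [this]
    exact continuous_const
  | n + 1 => by
    have : (orderedProduct : (Fin (n + 1) → SLd d) → SLd d) =
        fun A => orderedProduct (fun i : Fin n => A i.succ) * A 0 := funext orderedProduct_succ
    rw [this]
    exact ((continuous_orderedProduct n).comp (by fun_prop)).mul (continuous_apply 0)

theorem measurable_orderedProduct {d n : ℕ} :
    Measurable (orderedProduct : (Fin n → SLd d) → SLd d) :=
  (continuous_orderedProduct n).measurable

instance instIsProbabilityMeasureProductLaw {d n : ℕ} (μ : Fin n → ProbabilityMeasure (SLd d)) :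
    IsProbabilityMeasure (productLaw μ) :=
  inferInstanceAs (IsProbabilityMeasure (Measure.pi _))

/-- The law of the product `A_n ⋯ A_1`. -/
noncomputable def orderedProductLaw {d n : ℕ} (μ : Fin n → ProbabilityMeasure (SLd d)) :
    ProbabilityMeasure (SLd d) :=
  ⟨(productLaw μ).map orderedProduct,
    Measure.isProbabilityMeasure_map measurable_orderedProduct.aemeasurable⟩

theorem integral_productLaw_succ {d n : ℕ} (μ : Fin (n + 1) → ProbabilityMeasure (SLd d))
    {F : (Fin (n + 1) → SLd d) → ℝ} (hF : Integrable F (productLaw μ)) :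
    ∫ A, F A ∂(productLaw μ) = ∫ A, (∫ B, F (Fin.cons A B)
      ∂(productLaw fun i : Fin n => μ i.succ)) ∂(μ 0 : Measure (SLd d)) := by
  have hp := (measurePreserving_piFinSuccAbove (fun i => (μ i : Measure (SLd d))) 0).symm
  unfold productLaw at hF ⊢
  rw [← hp.integral_comp', integral_prod]
  · simp [MeasurableEquiv.piFinSuccAbove, Fin.insertNthEquiv]
  · exact hp.integrable_comp_of_integrable hF

theorem koopman_orderedProductLaw {d n : ℕ} (μ : Fin n → ProbabilityMeasure (SLd d))
    {g : (Fin d → ℝ) → ℝ} (hg : IsTestFunction g) (v : Fin d → ℝ) :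
    koopman (orderedProductLaw μ) g v = ∫ A, g (orderedProduct A • v) ∂(productLaw μ) := by
  refine integral_map measurable_orderedProduct.aemeasurable ?_
  exact (hg.measurable_smul.comp measurable_prodMk_right).aestronglyMeasurable

theorem koopman_orderedProductLaw_zero {d : ℕ} (μ : Fin 0 → ProbabilityMeasure (SLd d))
    {g : (Fin d → ℝ) → ℝ} (hg : IsTestFunction g) : koopman (orderedProductLaw μ) g = g := by
  funext v
  rw [koopman_orderedProductLaw μ hg]
  simp [orderedProduct]

/-- The matrix `A 0` acts first on vectors, so its operator is outermost on functions. -/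
theorem koopman_orderedProductLaw_succ {d n : ℕ} (μ : Fin (n + 1) → ProbabilityMeasure (SLd d))
    {g : (Fin d → ℝ) → ℝ} (hg : IsTestFunction g) :
    koopman (orderedProductLaw μ) g =
      koopman (μ 0) (koopman (orderedProductLaw fun i : Fin n => μ i.succ) g) := by
  funext v
  rw [koopman_orderedProductLaw μ hg, integral_productLaw_succ]
  · unfold koopman
    congr 1
    funext A
    rw [← koopman, koopman_orderedProductLaw _ hg]
    simp_rw [orderedProduct_cons, mul_smul]
  · exact Integrable.of_bound ((hg.measurable_smul.comp measurable_prodMk_right).comp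
      measurable_orderedProduct).aestronglyMeasurable 1 (ae_of_all _ fun _ => hg.norm_le_one _)

theorem integral_sq_koopman_orderedProductLaw_le {d : ℕ}
    {K : Set (ProbabilityMeasure (SLd d))} {q : ℝ}
    (H : ∀ μ ∈ K, ∀ g : (Fin d → ℝ) → ℝ, IsTestFunction g →
      ∫ v, koopman μ g v ^ 2 ≤ q ^ 2 * ∫ v, g v ^ 2) {g : (Fin d → ℝ) → ℝ}
    (hg : IsTestFunction g) : ∀ (n : ℕ) (μ : Fin n → ProbabilityMeasure (SLd d)),
      (∀ i, μ i ∈ K) →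
      ∫ v, koopman (orderedProductLaw μ) g v ^ 2 ≤ (q ^ 2) ^ n * ∫ v, g v ^ 2
  | 0, μ, _ => by simp [koopman_orderedProductLaw_zero μ hg]
  | n + 1, μ, hμ => by
    rw [koopman_orderedProductLaw_succ μ hg]
    refine (H _ (hμ 0) _ (hg.koopman _)).trans ?_
    rw [pow_succ' (q ^ 2) n, mul_assoc]
    exact mul_le_mul_of_nonneg_left
      (integral_sq_koopman_orderedProductLaw_le H hg n _ fun i => hμ i.succ) (sq_nonneg q)

/-! ### Operator norm, Euclidean balls and integrability. -/

theorem norm_toLp_smul_le {d : ℕ} (A : SLd d) (v : Fin d → ℝ) :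
    ‖WithLp.toLp 2 (A • v)‖ ≤ opNorm A * ‖WithLp.toLp 2 v‖ := by
  rw [smul_eq_mulVec, ← Matrix.toEuclideanCLM_toLp (𝕜 := ℝ)]
  exact ContinuousLinearMap.le_opNorm _ _

theorem opNorm_nonneg {d : ℕ} (A : SLd d) : 0 ≤ opNorm A := norm_nonneg _

theorem opNorm_mul_le {d : ℕ} (A B : SLd d) : opNorm (A * B) ≤ opNorm A * opNorm B := by
  unfold opNorm
  rw [Matrix.SpecialLinearGroup.coe_mul, map_mul]
  exact norm_mul_le _ _

theorem continuous_opNorm {d : ℕ} : Continuous (opNorm (d := d)) := by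
  have : Continuous (Matrix.toEuclideanCLM (n := Fin d) (𝕜 := ℝ)) :=
    LinearMap.continuous_of_finiteDimensional
      { toFun := Matrix.toEuclideanCLM (n := Fin d) (𝕜 := ℝ)
        map_add' := map_add _
        map_smul' := map_smul _ }
  exact (this.comp continuous_subtype_val).norm

/-- The closed Euclidean ball of radius `r` about the origin. -/
def euclideanBall (d : ℕ) (r : ℝ) : Set (Fin d → ℝ) := {v | ‖WithLp.toLp 2 v‖ ≤ r}

theorem continuous_norm_toLp {d : ℕ} : Continuous fun v : Fin d → ℝ => ‖WithLp.toLp 2 v‖ :=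
  (PiLp.continuous_toLp 2 _).norm

theorem measurableSet_euclideanBall (d : ℕ) (r : ℝ) : MeasurableSet (euclideanBall d r) :=
  (isClosed_le continuous_norm_toLp continuous_const).measurableSet

theorem volume_euclideanBall_lt_top (d : ℕ) (r : ℝ) : volume (euclideanBall d r) < ⊤ := by
  refine (measure_mono fun v hv => ?_).trans_lt (measure_closedBall_lt_top (x := 0) (r := r))
  have hv : ‖WithLp.toLp 2 v‖ ≤ r := hv
  have hr : 0 ≤ r := (norm_nonneg _).trans hv
  rw [mem_closedBall_zero_iff, pi_norm_le_iff_of_nonneg hr]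
  exact fun i => (PiLp.norm_apply_le (WithLp.toLp 2 v) i).trans hv

theorem volume_euclideanBall_one_pos (d : ℕ) : 0 < volume.real (euclideanBall d 1) := by
  refine ENNReal.toReal_pos (ne_of_gt ?_) (volume_euclideanBall_lt_top d 1).ne
  have ho : IsOpen {v : Fin d → ℝ | ‖WithLp.toLp 2 v‖ < 1} :=
    isOpen_lt continuous_norm_toLp continuous_const
  refine (ho.measure_pos volume ⟨0, by simp⟩).trans_le (measure_mono fun v hv => ?_)
  exact le_of_lt (show ‖WithLp.toLp 2 v‖ < 1 from hv)

open scoped Pointwise in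
theorem volume_euclideanBall {d : ℕ} {r : ℝ} (hr : 0 < r) :
    volume.real (euclideanBall d r) = r ^ d * volume.real (euclideanBall d 1) := by
  have : euclideanBall d r = r • euclideanBall d 1 := by
    ext v
    rw [Set.mem_smul_set_iff_inv_smul_mem₀ hr.ne']
    change _ ↔ ‖WithLp.toLp 2 (r⁻¹ • v)‖ ≤ 1
    rw [WithLp.toLp_smul, norm_smul, norm_inv, Real.norm_of_nonneg hr.le, inv_mul_le_iff₀ hr,
      mul_one]
    rfl
  rw [this, measureReal_def, Measure.addHaar_smul, ENNReal.toReal_mul,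
    ENNReal.toReal_ofReal (abs_nonneg _), Module.finrank_fin_fun, abs_of_pos (pow_pos hr d)]
  rfl

/-- Otherwise `A` would map the unit ball into a ball of radius `r < 1`, whose volume is smaller by
the factor `r ^ d`, although `A` preserves volume. -/
theorem one_le_opNorm {d : ℕ} [NeZero d] (A : SLd d) : 1 ≤ opNorm A := by
  by_contra! hlt
  have h0 := opNorm_nonneg A
  -- The midpoint is positive even while `opNorm A = 0` is not excluded.
  set r := (opNorm A + 1) / 2 with hr
  have hr0 : 0 < r := by linarith
  have hr1 : r < 1 := by linarith
  have hAr : opNorm A ≤ r := by linarith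
  have hsub : euclideanBall d 1 ⊆ (fun v => A • v) ⁻¹' euclideanBall d r := fun v hv => by
    have hv : ‖WithLp.toLp 2 v‖ ≤ 1 := hv
    change ‖WithLp.toLp 2 (A • v)‖ ≤ r
    calc _ ≤ opNorm A * ‖WithLp.toLp 2 v‖ := norm_toLp_smul_le A v
      _ ≤ r * 1 := mul_le_mul hAr hv (norm_nonneg _) hr0.le
      _ = r := mul_one r
  have hpre := (measurePreserving_smul_volume A).measure_preimage
    (measurableSet_euclideanBall d r).nullMeasurableSet
  have hle : volume.real (euclideanBall d 1) ≤ volume.real (euclideanBall d r) := by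
    refine ENNReal.toReal_mono (volume_euclideanBall_lt_top d r).ne ?_
    rw [← hpre]
    exact measure_mono hsub
  rw [volume_euclideanBall hr0] at hle
  have hpos := volume_euclideanBall_one_pos d
  have : r ^ d < 1 := pow_lt_one₀ hr0.le hr1 (NeZero.ne d)
  nlinarith

theorem log_opNorm_nonneg {d : ℕ} [NeZero d] (A : SLd d) : 0 ≤ Real.log (opNorm A) :=
  Real.log_nonneg (one_le_opNorm A)

theorem log_opNorm_orderedProduct_le {d : ℕ} [NeZero d] :
    ∀ {n : ℕ} (A : Fin n → SLd d),
      Real.log (opNorm (orderedProduct A)) ≤ ∑ i, Real.log (opNorm (A i))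
  | 0, A => by simp [orderedProduct, opNorm]
  | n + 1, A => by
    have hpos : ∀ B : SLd d, opNorm B ≠ 0 := fun B =>
      (zero_lt_one.trans_le (one_le_opNorm B)).ne'
    rw [orderedProduct_succ, Fin.sum_univ_succ, add_comm (Real.log _)]
    refine (Real.log_le_log (zero_lt_one.trans_le (one_le_opNorm _)) (opNorm_mul_le _ _)).trans ?_
    rw [Real.log_mul (hpos _) (hpos _)]
    gcongr
    exact log_opNorm_orderedProduct_le _

theorem measurable_log_opNorm {d : ℕ} : Measurable fun A : SLd d => Real.log (opNorm A) :=
  Real.measurable_log.comp continuous_opNorm.measurable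

theorem integrable_log_opNorm_orderedProduct {d n : ℕ} [NeZero d]
    (μ : Fin n → ProbabilityMeasure (SLd d)) (hμ : ∀ i, LogMomentCondition (μ i)) :
    Integrable (fun A => Real.log (opNorm (orderedProduct A))) (productLaw μ) := by
  have hsum : Integrable (fun A : Fin n → SLd d => ∑ i, Real.log (opNorm (A i)))
      (productLaw μ) := integrable_finsetSum _ fun i _ =>
    (measurePreserving_eval (fun i => (μ i : Measure (SLd d))) i).integrable_comp_of_integrable
      (hμ i)
  refine hsum.mono' (measurable_log_opNorm.comp measurable_orderedProduct).aestronglyMeasurable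
    (ae_of_all _ fun A => ?_)
  rw [Real.norm_of_nonneg (log_opNorm_nonneg _)]
  exact log_opNorm_orderedProduct_le A

theorem isTestFunction_indicator_euclideanBall (d : ℕ) :
    IsTestFunction ((euclideanBall d 1).indicator fun _ => (1 : ℝ)) where
  measurable := measurable_const.indicator (measurableSet_euclideanBall d 1)
  nonneg v := Set.indicator_nonneg (fun _ _ => zero_le_one) v
  le_one v := Set.indicator_le_self' (fun _ _ => zero_le_one) v
  integrable := (integrable_indicator_iff (measurableSet_euclideanBall d 1)).2
    (integrableOn_const (volume_euclideanBall_lt_top d 1).ne)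

/-- The ball of radius `(opNorm A)⁻¹` lies both in the unit ball and in its preimage under `A`. -/
theorem inv_opNorm_pow_mul_le_correlation {d : ℕ} [NeZero d] (A : SLd d) :
    (opNorm A)⁻¹ ^ d * volume.real (euclideanBall d 1) ≤
      ∫ v, (euclideanBall d 1).indicator (fun _ => (1 : ℝ)) (A • v) *
        (euclideanBall d 1).indicator (fun _ => (1 : ℝ)) v := by
  have h1 := one_le_opNorm A
  have h0 : 0 < opNorm A := zero_lt_one.trans_le h1
  have hg := isTestFunction_indicator_euclideanBall d
  rw [← volume_euclideanBall (inv_pos.2 h0),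
    ← integral_indicator_one (measurableSet_euclideanBall d _)]
  refine integral_mono ?_ ?_ fun v => ?_
  · exact (integrable_indicator_iff (measurableSet_euclideanBall d _)).2
      (integrableOn_const (volume_euclideanBall_lt_top d _).ne)
  · exact hg.integrable.bdd_mul
      (hg.measurable.comp (continuous_const_smul A).measurable).aestronglyMeasurable
      (ae_of_all _ fun v => hg.norm_le_one (A • v))
  · by_cases hv : v ∈ euclideanBall d (opNorm A)⁻¹
    · have hv' : ‖WithLp.toLp 2 v‖ ≤ (opNorm A)⁻¹ := hv
      have m1 : v ∈ euclideanBall d 1 := hv'.trans (inv_le_one_of_one_le₀ h1)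
      have m2 : A • v ∈ euclideanBall d 1 := by
        change ‖WithLp.toLp 2 (A • v)‖ ≤ 1
        calc _ ≤ opNorm A * ‖WithLp.toLp 2 v‖ := norm_toLp_smul_le A v
          _ ≤ opNorm A * (opNorm A)⁻¹ := by gcongr
          _ = 1 := mul_inv_cancel₀ h0.ne'
      simp [hv, m1, m2]
    · rw [Set.indicator_of_notMem hv]
      exact mul_nonneg (hg.nonneg _) (hg.nonneg _)

theorem measurable_inv_opNorm_pow {d : ℕ} : Measurable fun A : SLd d => (opNorm A)⁻¹ ^ d :=
  (continuous_opNorm.measurable.inv).pow_const d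

theorem integrable_inv_opNorm_pow {d : ℕ} [NeZero d] (μ : ProbabilityMeasure (SLd d)) :
    Integrable (fun A : SLd d => (opNorm A)⁻¹ ^ d) (μ : Measure (SLd d)) := by
  refine Integrable.of_bound measurable_inv_opNorm_pow.aestronglyMeasurable 1
    (ae_of_all _ fun A => ?_)
  have h : 0 ≤ (opNorm A)⁻¹ := inv_nonneg.2 (opNorm_nonneg A)
  rw [norm_pow, Real.norm_of_nonneg h]
  exact pow_le_one₀ h (inv_le_one_of_one_le₀ (one_le_opNorm A))

/-! ### Negative moments and linear growth. -/

/-- Contraction of the averaged Koopman operator bounds a negative moment of the norm. -/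
theorem integral_inv_opNorm_pow_le {d : ℕ} [NeZero d] {μ : ProbabilityMeasure (SLd d)} {r : ℝ}
    (hr : 0 < r) (H : ∀ g : (Fin d → ℝ) → ℝ, IsTestFunction g →
      ∫ v, koopman μ g v ^ 2 ≤ r ^ 2 * ∫ v, g v ^ 2) :
    ∫ A, (opNorm A)⁻¹ ^ d ∂(μ : Measure (SLd d)) ≤ r := by
  have hV := volume_euclideanBall_one_pos d
  set V := volume.real (euclideanBall d 1) with hVdef
  have hg := isTestFunction_indicator_euclideanBall d
  set g : (Fin d → ℝ) → ℝ := (euclideanBall d 1).indicator fun _ => (1 : ℝ) with hgdef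
  have hf := hg.koopman μ
  have hg2 : ∫ v, g v ^ 2 = V := by
    have : (fun v => g v ^ 2) = (euclideanBall d 1).indicator 1 := by
      funext v
      by_cases hv : v ∈ euclideanBall d 1 <;> simp [hgdef, hv]
    rw [this, integral_indicator_one (measurableSet_euclideanBall d 1)]
  have hcorr : Integrable (fun A : SLd d => ∫ v, g (A • v) * g v) (μ : Measure (SLd d)) := by
    have hm : Integrable (fun p : SLd d × (Fin d → ℝ) => g (p.1 • p.2) * g p.2)
        ((μ : Measure (SLd d)).prod volume) :=
      (hg.integrable_smul_prod μ).mul_bdd (c := 1)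
        (hg.measurable.comp measurable_snd).aestronglyMeasurable
        (ae_of_all _ fun p => hg.norm_le_one _)
    exact hm.integral_prod_left
  have h1 : (∫ A, (opNorm A)⁻¹ ^ d ∂(μ : Measure (SLd d))) * V ≤ ∫ v, koopman μ g v * g v := by
    rw [← hg.integral_correlation hg μ, ← integral_mul_const]
    exact integral_mono ((integrable_inv_opNorm_pow μ).mul_const V) hcorr
      inv_opNorm_pow_mul_le_correlation
  -- Cauchy–Schwarz again as a weighted inequality; with weight `r`, each of the two terms
  -- contributes at most `r / 2 * V`.
  have h2 : ∫ v, koopman μ g v * g v ≤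
      ∫ v, ((2 * r)⁻¹ * koopman μ g v ^ 2 + r / 2 * g v ^ 2) := by
    refine integral_mono (hg.integrable.bdd_mul hf.measurable.aestronglyMeasurable
      (ae_of_all _ hf.norm_le_one))
      ((hf.integrable_sq.const_mul _).add (hg.integrable_sq.const_mul _)) fun v => ?_
    have : (2 * r)⁻¹ * koopman μ g v ^ 2 + r / 2 * g v ^ 2 - koopman μ g v * g v =
        (2 * r)⁻¹ * (koopman μ g v - r * g v) ^ 2 := by
      field_simp
      ring
    have : 0 ≤ (2 * r)⁻¹ * (koopman μ g v - r * g v) ^ 2 := by positivity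
    linarith
  rw [integral_add (hf.integrable_sq.const_mul _) (hg.integrable_sq.const_mul _),
    integral_const_mul, integral_const_mul] at h2
  have h3 : (2 * r)⁻¹ * ∫ v, koopman μ g v ^ 2 ≤ (2 * r)⁻¹ * (r ^ 2 * ∫ v, g v ^ 2) :=
    mul_le_mul_of_nonneg_left (H g hg) (by positivity)
  rw [hg2] at h2 h3
  have h4 : (2 * r)⁻¹ * (r ^ 2 * V) = r / 2 * V := by field_simp
  refine le_of_mul_le_mul_right ?_ hV
  linarith

/-- Jensen's inequality for `exp`, applied to `-d log ‖A‖`. -/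
theorem neg_log_le_integral_log_opNorm {d : ℕ} [NeZero d] {μ : ProbabilityMeasure (SLd d)} {r : ℝ}
    (hr : 0 < r) (hint : LogMomentCondition μ)
    (h : ∫ A, (opNorm A)⁻¹ ^ d ∂(μ : Measure (SLd d)) ≤ r) :
    -Real.log r / d ≤ ∫ A, Real.log (opNorm A) ∂(μ : Measure (SLd d)) := by
  have hd : (0 : ℝ) < d := Nat.cast_pos.2 (NeZero.pos d)
  set m := ∫ A, Real.log (opNorm A) ∂(μ : Measure (SLd d)) with hm
  have hexp : ∀ A : SLd d, (opNorm A)⁻¹ ^ d = Real.exp (-d * Real.log (opNorm A)) := fun A => by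
    have h0 : 0 < opNorm A := zero_lt_one.trans_le (one_le_opNorm A)
    rw [neg_mul, Real.exp_neg, mul_comm, Real.exp_mul, Real.exp_log h0, Real.rpow_natCast, inv_pow]
  have hJ : Real.exp (-d * m) ≤ r := by
    refine le_trans ?_ h
    simp_rw [hexp]
    have := convexOn_exp.map_integral_le (μ := (μ : Measure (SLd d)))
      (f := fun A => -d * Real.log (opNorm A)) Real.continuous_exp.continuousOn isClosed_univ
      (ae_of_all _ fun _ => Set.mem_univ _) (hint.const_mul _)
      (by simpa only [Function.comp_def, ← hexp] using integrable_inv_opNorm_pow μ)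
    rwa [integral_const_mul] at this
  rw [div_le_iff₀ hd]
  have := (Real.le_log_iff_exp_le hr).2 hJ
  linarith

theorem expectedLogNorm_eq_integral {d n : ℕ} (μ : Fin n → ProbabilityMeasure (SLd d)) :
    expectedLogNorm μ =
      ∫ A, Real.log (opNorm A) ∂(orderedProductLaw μ : Measure (SLd d)) :=
  (integral_map measurable_orderedProduct.aemeasurable
    measurable_log_opNorm.aestronglyMeasurable).symm

theorem logMomentCondition_orderedProductLaw {d n : ℕ} [NeZero d]
    (μ : Fin n → ProbabilityMeasure (SLd d)) (hμ : ∀ i, LogMomentCondition (μ i)) :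
    LogMomentCondition (orderedProductLaw μ) :=
  (integrable_map_measure measurable_log_opNorm.aestronglyMeasurable
    measurable_orderedProduct.aemeasurable).2 (integrable_log_opNorm_orderedProduct μ hμ)

/-- Uniform linear growth of the expected logarithm of the norm. -/
theorem exists_linear_growth {d : ℕ} [NeZero d] {K : Set (ProbabilityMeasure (SLd d))}
    (hK : IsCompact K) (hlog : ∀ μ ∈ K, LogMomentCondition μ)
    (hmeas : ∀ μ ∈ K, MeasuresCondition μ) :
    ∃ lam : ℝ, 0 < lam ∧ ∀ (n : ℕ) (μ : Fin n → ProbabilityMeasure (SLd d)), (∀ i, μ i ∈ K) →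
      (n : ℝ) * lam ≤ expectedLogNorm μ := by
  obtain ⟨q, hq0, hq1, H⟩ := exists_koopman_gap hK hmeas
  have hd : (0 : ℝ) < d := Nat.cast_pos.2 (NeZero.pos d)
  refine ⟨-Real.log q / d, div_pos (neg_pos.2 (Real.log_neg hq0 hq1)) hd, fun n μ hμ => ?_⟩
  rw [expectedLogNorm_eq_integral]
  have hneg := integral_inv_opNorm_pow_le (μ := orderedProductLaw μ) (pow_pos hq0 n)
    fun g hg => by
      rw [← pow_mul, mul_comm n, pow_mul]
      exact integral_sq_koopman_orderedProductLaw_le H hg n μ hμ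
  have := neg_log_le_integral_log_opNorm (pow_pos hq0 n)
    (logMomentCondition_orderedProductLaw μ fun i => hlog _ (hμ i)) hneg
  rw [Real.log_pow] at this
  refine le_trans (le_of_eq ?_) this
  ring

end RandomMatrix

theorem theorem1p4 (d : ℕ) (hd : 1 ≤ d)
    (K : Set (ProbabilityMeasure (RandomMatrix.SLd d))) (hK : IsCompact K)
    (hlog : ∀ μ ∈ K, RandomMatrix.LogMomentCondition μ)
    (hmeas : ∀ μ ∈ K, RandomMatrix.MeasuresCondition μ) :
    ∃ lam : ℝ, 0 < lam ∧
      (∀ (n : ℕ) (μ : Fin n → ProbabilityMeasure (RandomMatrix.SLd d)), (∀ i, μ i ∈ K) →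
        Integrable (fun A : Fin n → RandomMatrix.SLd d =>
            Real.log (RandomMatrix.opNorm (RandomMatrix.orderedProduct A)))
          (RandomMatrix.productLaw μ) ∧
        (n : ℝ) * lam ≤ RandomMatrix.expectedLogNorm μ) ∧
      (∀ μ : ℕ → ProbabilityMeasure (RandomMatrix.SLd d), (∀ i, μ i ∈ K) →
        (lam : EReal) ≤ liminf
          (fun n : ℕ =>
            (((1 / (n : ℝ)) * RandomMatrix.expectedLogNorm (fun i : Fin n => μ i) : ℝ) : EReal))
          atTop) := by
  have : NeZero d := ⟨by omega⟩
  obtain ⟨lam, hlam, H⟩ := RandomMatrix.exists_linear_growth hK hlog hmeas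
  refine ⟨lam, hlam, fun n μ hμ => ⟨RandomMatrix.integrable_log_opNorm_orderedProduct μ
    fun i => hlog _ (hμ i), H n μ hμ⟩, fun μ hμ => ?_⟩
  refine le_liminf_of_le (by isBoundedDefault) ?_
  -- At `n = 0` the quotient is `0` by convention and the bound would fail.
  filter_upwards [eventually_gt_atTop 0] with n hn
  have hn' : (0 : ℝ) < n := Nat.cast_pos.2 hn
  rw [EReal.coe_le_coe_iff, one_div, ← div_eq_inv_mul, le_div_iff₀ hn', mul_comm]
  exact H n (fun i : Fin n => μ i) fun i => hμ i
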